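/- Let $M$ be a smooth compact connected manifold with (possibly empty) boundary, let $P$ be $\mathbb R$ or the circle $S^1$, and give $C^\infty(M,P)$ the $C^\infty$ (Whitney) topology. Let $f\in C^\infty(M,P)$ be constant on each connected component of $\partial M$ and have only finitely many critical values. For a map $g\in C^\infty(M,P)$, a point $x\in M$ is critical if $dg(x)=0$, and the exceptional values of $g$ are its critical values together with its values on $\partial M$. Let $n$ be the number of exceptional values of $f$ (it is finite). A critical point $x$ of $f$ is called essential if for every neighbourhood $U$ of $x$ there is a neighbourhood $N$ of $f$ in $C^\infty(M,P)$ such that each $g\in N$ has a critical point in $U$. If $P=\mathbb R$, let $\mathcal D_P(f)$ be the group of orientation preserving diffeomorphisms of $\mathbb R$ with compact support that leave the image $f(M)$ invariant; if $P=S^1$, let $\mathcal D_P(f)$ be the group of all orientation preserving diffeomorphisms of $S^1$. Let $$\mathcal O_{M\times P}(f)=\{\phi\circ f\circ h^{-1} : h\in \mathrm{Diff}(M),\ \phi\in\mathcal D_P(f)\},$$ with the topology induced from $C^\infty(M,P)$. Suppose that for every critical value $c$ of $f$ the level set $f^{-1}(c)$ contains a connected component of $\partial M$ or an essential critical point of $f$.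 (1) If $P=\mathbb R$, then every $g\in\mathcal O_{M\times\mathbb R}(f)$ has exactly $n$ exceptional values $x_1(g)<\dots<x_n(g)$, with $x_1(g)=\min f$ and $x_n(g)=\max f$, and the map $g\mapsto (x_1(g),\dots,x_n(g))$ from $\mathcal O_{M\times\mathbb R}(f)$ to $\{x\in\mathbb R^n : x_1<\dots<x_n,\ x_1=\min f,\ x_n=\max f\}$ is continuous. (2) If $P=S^1$, let $\mathcal F_n$ be the connected component of the point $(e^{2\pi i/n},e^{4\pi i/n},\dots,e^{2\pi i n/n})$ in the space of $n$-tuples of pairwise distinct points of $S^1$ (a one-point space if $n=0$), on which $\mathbb Z_n$ acts by cyclic shifts of the coordinates. Then for every $g\in\mathcal O_{M\times S^1}(f)$ the tuples in $\mathcal F_n$ whose set of coordinates is the set of exceptional values of $g$ form exactly one $\mathbb Z_n$-orbit, and the map $\mathcal O_{M\times S^1}(f)\to\mathcal F_n/\mathbb Z_n$ that sends $g$ to this orbit is continuous. -/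

import Mathlib

open Set Function Topology
open scoped Manifold ContDiff

/-- The model with corners `I` is a model for manifolds with (possibly empty) boundary, without
corners: its range is the whole space (`ℓ = 0`) or a closed half-space (`ℓ ≠ 0`). -/
def IsBoundaryModel {m : ℕ} {H : Type*} [TopologicalSpace H]
    (I : ModelWithCorners ℝ (EuclideanSpace ℝ (Fin m)) H) : Prop :=
  ∃ ℓ : EuclideanSpace ℝ (Fin m) →L[ℝ] ℝ, range I = {x | 0 ≤ ℓ x}

section SmoothMaps

variable {E : Type*} [NormedAddCommGroup E] [NormedSpace ℝ E]
  {H : Type*} [TopologicalSpace H] {I : ModelWithCorners ℝ E H}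
  {M : Type*} [TopologicalSpace M] [ChartedSpace H M]
  {F : Type*} [NormedAddCommGroup F] [NormedSpace ℝ F]
  {G : Type*} [TopologicalSpace G] {J : ModelWithCorners ℝ F G}
  {P : Type*} [TopologicalSpace P] [ChartedSpace G P]

/-- The set of smooth maps `g` with `g(K)` inside the domain of the chart `e'`, such that in the
charts `e`, `e'` all derivatives of order at most `r` of `g` and of `f` differ by less than `ε`
at each point of `K`. -/
def smoothNhd (f : ContMDiffMap I J M P ∞) (e : OpenPartialHomeomorph M H)
    (e' : OpenPartialHomeomorph P G) (K : Set M) (r : ℕ) (ε : ℝ) :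
    Set (ContMDiffMap I J M P ∞) :=
  {g | MapsTo g K e'.source ∧ ∀ k ≤ r, ∀ x ∈ K,
    ‖iteratedFDerivWithin ℝ k (e'.extend J ∘ g ∘ (e.extend I).symm) (range I) (e.extend I x)
      - iteratedFDerivWithin ℝ k (e'.extend J ∘ f ∘ (e.extend I).symm) (range I) (e.extend I x)‖
      < ε}

/-- The `C^∞` topology on the space of smooth maps `M → P`: uniform convergence of all derivatives
in smooth charts on compact sets. For compact `M` it is also the Whitney `C^∞` topology. -/
instance smoothTopology : TopologicalSpace (ContMDiffMap I J M P ∞) :=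
  TopologicalSpace.generateFrom
    {U | ∃ (f : ContMDiffMap I J M P ∞) (e : OpenPartialHomeomorph M H)
        (e' : OpenPartialHomeomorph P G) (K : Set M) (r : ℕ) (ε : ℝ),
      e ∈ IsManifold.maximalAtlas I ∞ M ∧ e' ∈ IsManifold.maximalAtlas J ∞ P ∧
      IsCompact K ∧ K ⊆ e.source ∧ MapsTo f K e'.source ∧ 0 < ε ∧
      U = smoothNhd f e e' K r ε}

/-- Critical points of a smooth map to a one-dimensional manifold. -/
def IsCriticalPt (f : ContMDiffMap I J M P ∞) (x : M) : Prop :=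
  mfderiv I J f x = 0

/-- The set of critical values. -/
def criticalValues (f : ContMDiffMap I J M P ∞) : Set P :=
  f '' {x | IsCriticalPt f x}

/-- The exceptional values: the critical values and the values on the boundary. -/
def exceptionalValues (f : ContMDiffMap I J M P ∞) : Set P :=
  criticalValues f ∪ f '' I.boundary M

/-- `f` is constant on each connected component of the boundary and has only finitely many
critical values. -/
def BoundaryConstFinCrit (f : ContMDiffMap I J M P ∞) : Prop :=
  (∀ x ∈ I.boundary M, ∀ y ∈ connectedComponentIn (I.boundary M) x, f y = f x) ∧
    (criticalValues f).Finite

/-- A critical point `x` of `f` is essential if for each neighbourhood `U` of `x`, all smooth maps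
in some `C^∞` neighbourhood of `f` have a critical point in `U`. -/
def IsEssentialCriticalPt (f : ContMDiffMap I J M P ∞) (x : M) : Prop :=
  IsCriticalPt f x ∧ ∀ U ∈ 𝓝 x, ∃ N ∈ 𝓝 f, ∀ g ∈ N, ∃ y ∈ U, IsCriticalPt g y

/-- Each critical level set contains a connected component of the boundary or an essential
critical point. -/
def CriticalLevelCondition (f : ContMDiffMap I J M P ∞) : Prop :=
  ∀ c ∈ criticalValues f,
    (∃ x ∈ I.boundary M, connectedComponentIn (I.boundary M) x ⊆ f ⁻¹' {c}) ∨
    (∃ x ∈ f ⁻¹' {c}, IsEssentialCriticalPt f x)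

/-- The orbit of `f` under the left-right action of the diffeomorphisms `h` of `M` and
the diffeomorphisms `φ` of `P` that belong to `D`: all maps `φ ∘ f ∘ h⁻¹`. -/
def leftRightOrbit (D : Set (Diffeomorph J J P P ∞)) (f : ContMDiffMap I J M P ∞) :
    Set (ContMDiffMap I J M P ∞) :=
  {g | ∃ h : Diffeomorph I I M M ∞, ∃ φ ∈ D, ∀ x, g x = φ (f (h.symm x))}

/-- Diffeomorphisms of the line that preserve orientation, have compact support and leave
the image of `f` invariant. -/
def lineDiffeos (f : ContMDiffMap I 𝓘(ℝ, ℝ) M ℝ ∞) :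
    Set (Diffeomorph 𝓘(ℝ, ℝ) 𝓘(ℝ, ℝ) ℝ ℝ ∞) :=
  {φ | StrictMono φ ∧ HasCompactSupport (fun t : ℝ => φ t - t) ∧ φ '' range f = range f}

end SmoothMaps

/-- Orientation preserving diffeomorphisms of the circle: those that lift to an increasing
map of the line. -/
def circleDiffeos : Set (Diffeomorph (𝓡 1) (𝓡 1) Circle Circle ∞) :=
  {φ | ∃ F : ℝ → ℝ, Continuous F ∧ StrictMono F ∧ ∀ t, φ (Circle.exp t) = Circle.exp (F t)}

/-- The tuples `x₁ < x₂ < ⋯ < xₙ` of real numbers with `x₁ = a` and `xₙ = b`. -/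
abbrev OrderedConf (n : ℕ) (a b : ℝ) : Type :=
  {x : Fin n → ℝ // StrictMono x ∧ (∀ i : Fin n, (i : ℕ) = 0 → x i = a) ∧
    (∀ i : Fin n, (i : ℕ) + 1 = n → x i = b)}

/-- The connected component, in the configuration space of `n` distinct points of the circle, of
`n` equally spaced points listed in their cyclic order. -/
abbrev CircleConf (n : ℕ) : Type :=
  {x : Fin n → Circle // x ∈ connectedComponentIn {y : Fin n → Circle | Injective y}
    (fun i => Circle.exp (2 * Real.pi * ((i : ℝ) + 1) / n))}

/-- Two configurations are equivalent if they differ by a cyclic shift of the coordinates. -/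
def cyclicShiftSetoid (n : ℕ) : Setoid (CircleConf n) where
  r x y := ∃ k : ℤ, y.1 = x.1 ∘ (finRotate n ^ k : Equiv.Perm (Fin n))
  iseqv :=
    { refl := fun x => ⟨0, by simp⟩
      symm := by
        rintro x y ⟨k, hk⟩
        refine ⟨-k, ?_⟩
        rw [hk]
        funext i
        simp [zpow_neg]
      trans := by
        rintro x y z ⟨k, hk⟩ ⟨l, hl⟩
        refine ⟨k + l, ?_⟩
        rw [hl, hk]
        funext i
        simp [zpow_add] }

/-- Cyclically ordered `n`-point subsets of the circle, with the quotient topology. -/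
abbrev CyclicConf (n : ℕ) : Type := Quotient (cyclicShiftSetoid n)

/-!
The exceptional values of a map in the orbit move continuously because none of them can disappear
and their number is constant.

Constancy: `φ ∘ f ∘ h⁻¹` has as exceptional values the images under `φ` of those of `f`
(`exceptionalValues_leftRight`), as diffeomorphisms preserve critical points and the boundary.
There are finitely many of them, because `∂M` is compact and its components are relatively open
(`finite_image_boundary`).

Persistence: by the assumption on critical levels, each exceptional value `c` of `f` is taken at
a boundary point or at an essential critical point. As evaluation is continuous in the `C^∞`
topology (`continuous_eval_contMDiffMap`), every map near `f` then has an exceptional value near `c`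
(`eventually_exceptionalValues_inter_nonempty`). The same holds at each point of the orbit, since
`g ↦ φ ∘ g ∘ h⁻¹` is a homeomorphism of the space of smooth maps and so carries essential critical
points to essential critical points. Its continuity (`continuous_leftRight`) is formal: it
only replaces the charts in a subbasic open set by their composites with `h` and `φ`.

A family of `n`-point sets all of whose points persist has enumerations that are close to a given
one (`eventually_exists_enumeration`). On the line this yields continuity of the increasing
enumeration; its ends are the extrema, which are exceptional values since an interior extremum
is a critical point. On the circle, the component of the equally spaced configuration
is identified with the open set of cyclically ordered tuples, those whose angles measured from the
last point increase (`connectedComponentIn_equallySpaced`). It follows that every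
`n`-point set is listed by exactly one orbit of cyclic shifts (`exists_circleConf`,
`circleConf_mk_eq_iff`), and that nearby enumerations stay in the component.
-/

section Transport

variable {E : Type*} [NormedAddCommGroup E] [NormedSpace ℝ E]
  {H : Type*} [TopologicalSpace H] {I : ModelWithCorners ℝ E H}
  {M : Type*} [TopologicalSpace M] [ChartedSpace H M]
  {F : Type*} [NormedAddCommGroup F] [NormedSpace ℝ F]
  {G : Type*} [TopologicalSpace G] {J : ModelWithCorners ℝ F G}
  {P : Type*} [TopologicalSpace P] [ChartedSpace G P]

/-! ### The left-right action of diffeomorphisms -/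

/-- A smooth chart precomposed with a diffeomorphism is a smooth chart. -/
lemma Diffeomorph.trans_mem_maximalAtlas [IsManifold I ∞ M] (h : Diffeomorph I I M M ∞)
    {e : OpenPartialHomeomorph M H} (he : e ∈ IsManifold.maximalAtlas I ∞ M) :
    h.toHomeomorph.toOpenPartialHomeomorph.trans e ∈ IsManifold.maximalAtlas I ∞ M := by
  apply OpenPartialHomeomorph.mem_maximalAtlas_of_contMDiffOn
  · exact (contMDiffOn_of_mem_maximalAtlas he).comp h.contMDiff.contMDiffOn
      fun x hx => by simpa using hx
  · exact h.symm.contMDiff.comp_contMDiffOn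
      ((contMDiffOn_symm_of_mem_maximalAtlas he).mono fun x hx => by simpa using hx)

/-- The smooth map `φ ∘ g ∘ h⁻¹`. -/
noncomputable def leftRight (φ : Diffeomorph J J P P ∞) (h : Diffeomorph I I M M ∞)
    (g : ContMDiffMap I J M P ∞) : ContMDiffMap I J M P ∞ :=
  ⟨fun x => φ (g (h.symm x)), φ.contMDiff.comp (g.contMDiff.comp h.symm.contMDiff)⟩

@[simp] lemma leftRight_apply (φ : Diffeomorph J J P P ∞) (h : Diffeomorph I I M M ∞)
    (g : ContMDiffMap I J M P ∞) (x : M) : leftRight φ h g x = φ (g (h.symm x)) := rfl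

@[simp] lemma leftRight_symm_leftRight (φ : Diffeomorph J J P P ∞) (h : Diffeomorph I I M M ∞)
    (g : ContMDiffMap I J M P ∞) : leftRight φ.symm h.symm (leftRight φ h g) = g := by
  ext x
  exact (φ.symm_apply_apply _).trans (congrArg g (h.symm_apply_apply x))

lemma exists_eq_leftRight {D : Set (Diffeomorph J J P P ∞)} {f g : ContMDiffMap I J M P ∞}
    (hg : g ∈ leftRightOrbit D f) :
    ∃ φ ∈ D, ∃ h : Diffeomorph I I M M ∞, g = leftRight φ h f := by
  obtain ⟨h, φ, hφ, hg⟩ := hg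
  exact ⟨φ, hφ, h, ContMDiffMap.ext hg⟩

lemma range_leftRight (φ : Diffeomorph J J P P ∞) (h : Diffeomorph I I M M ∞)
    (g : ContMDiffMap I J M P ∞) : range (leftRight φ h g) = φ '' range g := by
  rw [← range_comp, ← h.symm.surjective.range_comp (φ ∘ g)]
  rfl

/-- No estimates on derivatives of composite maps are needed: `leftRight φ h` pulls the subbasic
set given by the charts `e`, `e'` back to the subbasic set given by the charts `e ∘ h`, `e' ∘ φ`,
with the same coordinate expressions. -/
lemma continuous_leftRight [IsManifold I ∞ M] [IsManifold J ∞ P]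
    (φ : Diffeomorph J J P P ∞) (h : Diffeomorph I I M M ∞) :
    Continuous (leftRight φ h : ContMDiffMap I J M P ∞ → ContMDiffMap I J M P ∞) := by
  refine continuous_generateFrom_iff.2 ?_
  rintro _ ⟨f, e, e', K, r, ε, he, he', hK, hKe, hf, hε, rfl⟩
  apply TopologicalSpace.isOpen_generateFrom_of_mem
  refine ⟨leftRight φ.symm h.symm f, h.toHomeomorph.toOpenPartialHomeomorph.trans e,
    φ.toHomeomorph.toOpenPartialHomeomorph.trans e', h ⁻¹' K, r, ε,
    h.trans_mem_maximalAtlas he, φ.trans_mem_maximalAtlas he',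
    h.toHomeomorph.isCompact_preimage.2 hK, ?_, ?_, hε, ?_⟩
  · intro x hx
    simpa using hKe hx
  · intro x hx
    simpa using! hf hx
  · ext g
    have h1 : ((φ.toHomeomorph.toOpenPartialHomeomorph.trans e').extend J ∘
        leftRight φ.symm h.symm f ∘
        ((h.toHomeomorph.toOpenPartialHomeomorph.trans e).extend I).symm) =
        e'.extend J ∘ f ∘ (e.extend I).symm := by
      ext x
      simp
    have h2 : ((φ.toHomeomorph.toOpenPartialHomeomorph.trans e').extend J ∘ g ∘
        ((h.toHomeomorph.toOpenPartialHomeomorph.trans e).extend I).symm) =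
        e'.extend J ∘ (leftRight φ h g) ∘ (e.extend I).symm := by
      ext x
      simp
    simp only [smoothNhd, mem_preimage, mem_ofPred_eq, h1, h2]
    refine and_congr ⟨fun H x hx => ?_, fun H x hx => ?_⟩ (forall₂_congr fun k _ =>
      ⟨fun H x hx => ?_, fun H x hx => ?_⟩)
    · simpa using H (show h x ∈ K from hx)
    · simpa using H (show h.symm x ∈ h ⁻¹' K by simpa using hx)
    · simpa using H (h x) hx
    · simpa using H (h.symm x) (by simpa using hx)

lemma IsCriticalPt.leftRight {g : ContMDiffMap I J M P ∞} {x : M} (hx : IsCriticalPt g x)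
    (φ : Diffeomorph J J P P ∞) (h : Diffeomorph I I M M ∞) :
    IsCriticalPt (leftRight φ h g) (h x) := by
  have hg : HasMFDerivAt I J g (h.symm (h x)) 0 := by
    rw [h.symm_apply_apply, ← show mfderiv I J g x = 0 from hx]
    exact (g.contMDiff.mdifferentiable (by simp) x).hasMFDerivAt
  have hh := (h.symm.contMDiff.mdifferentiable (by simp) (h x)).hasMFDerivAt
  have hφ := (φ.contMDiff.mdifferentiable (by simp) (g (h.symm (h x)))).hasMFDerivAt
  refine (hφ.comp (h x) (hg.comp (h x) hh)).mfderiv.trans ?_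
  rw [ContinuousLinearMap.zero_comp, ContinuousLinearMap.comp_zero]
  rfl

/-- Essential critical points are transported by diffeomorphisms, as the left-right action is by
homeomorphisms of the space of smooth maps. -/
lemma IsEssentialCriticalPt.leftRight [IsManifold I ∞ M] [IsManifold J ∞ P]
    {g : ContMDiffMap I J M P ∞} {x : M} (hx : IsEssentialCriticalPt g x)
    (φ : Diffeomorph J J P P ∞) (h : Diffeomorph I I M M ∞) :
    IsEssentialCriticalPt (leftRight φ h g) (h x) := by
  refine ⟨hx.1.leftRight φ h, fun U hU => ?_⟩
  obtain ⟨N, hN, H⟩ := hx.2 (h ⁻¹' U) (h.continuous.continuousAt hU)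
  refine ⟨_root_.leftRight φ.symm h.symm ⁻¹' N,
    (continuous_leftRight φ.symm h.symm).continuousAt (by simpa using hN), fun g' hg' => ?_⟩
  obtain ⟨y, hy, hc⟩ := H _ hg'
  exact ⟨h y, hy, by simpa using! hc.leftRight φ.symm.symm h.symm.symm⟩

/-- The values that persist under small perturbations: the values on the boundary and at essential
critical points. -/
def stableValues (f : ContMDiffMap I J M P ∞) : Set P :=
  f '' I.boundary M ∪ f '' {x | IsEssentialCriticalPt f x}

lemma CriticalLevelCondition.exceptionalValues_subset_stableValues
    {f : ContMDiffMap I J M P ∞} (hf : CriticalLevelCondition f) :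
    exceptionalValues f ⊆ stableValues f := by
  rintro c (hc | hc)
  · rcases hf c hc with ⟨x, hx, hxc⟩ | ⟨x, hxc, hx⟩
    · exact Or.inl ⟨x, hx, hxc (mem_connectedComponentIn hx)⟩
    · exact Or.inr ⟨x, hx, hxc⟩
  · exact Or.inl hc

lemma image_stableValues_subset [FiniteDimensional ℝ E] [IsManifold I ∞ M] [IsManifold J ∞ P]
    (φ : Diffeomorph J J P P ∞) (h : Diffeomorph I I M M ∞) (g : ContMDiffMap I J M P ∞) :
    φ '' stableValues g ⊆ stableValues (leftRight φ h g) := by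
  rintro _ ⟨_, ⟨x, hx, rfl⟩ | ⟨x, hx, rfl⟩, rfl⟩
  · refine Or.inl ⟨h x, ?_, by simp⟩
    rwa [← h.preimage_boundary (by simp)] at hx
  · exact Or.inr ⟨h x, hx.leftRight φ h, by simp⟩

lemma image_exceptionalValues_subset [FiniteDimensional ℝ E] [IsManifold I ∞ M]
    (φ : Diffeomorph J J P P ∞) (h : Diffeomorph I I M M ∞) (g : ContMDiffMap I J M P ∞) :
    φ '' exceptionalValues g ⊆ exceptionalValues (leftRight φ h g) := by
  rintro _ ⟨_, ⟨x, hx, rfl⟩ | ⟨x, hx, rfl⟩, rfl⟩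
  · exact Or.inl ⟨h x, IsCriticalPt.leftRight hx φ h, by simp⟩
  · refine Or.inr ⟨h x, ?_, by simp⟩
    rwa [← h.preimage_boundary (by simp)] at hx

lemma exceptionalValues_leftRight [FiniteDimensional ℝ E] [IsManifold I ∞ M]
    (φ : Diffeomorph J J P P ∞) (h : Diffeomorph I I M M ∞) (g : ContMDiffMap I J M P ∞) :
    exceptionalValues (leftRight φ h g) = φ '' exceptionalValues g := by
  refine Subset.antisymm (fun c hc => ⟨φ.symm c, ?_, by simp⟩)
    (image_exceptionalValues_subset φ h g)
  simpa using image_exceptionalValues_subset φ.symm h.symm _ (mem_image_of_mem φ.symm hc)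

/-! ### Persistence of stable values -/

/-- Evaluation is jointly continuous, since the `C^∞` topology is finer than that of locally
uniform convergence. -/
lemma continuous_eval_contMDiffMap [IsManifold I ∞ M] [IsManifold J ∞ P] [LocallyCompactSpace M] :
    Continuous fun p : ContMDiffMap I J M P ∞ × M => p.1 p.2 := by
  refine continuous_iff_continuousAt.2 fun ⟨g, x⟩ => ?_
  intro V hV
  set e := chartAt H x
  set e' := chartAt G (g x)
  have hx : x ∈ e.source := mem_chart_source H x
  have hgx : g x ∈ e'.source := mem_chart_source G (g x)
  have hg : ContinuousAt g x := g.contMDiff.continuous.continuousAt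
  -- In the chart `e'`, values within `2 * ε` of that of `g x` belong to `V`.
  have hsymm : (e'.extend J).symm ⁻¹' V ∈ 𝓝 (e'.extend J (g x)) :=
    continuousAt_extChartAt_symm (g x) (by simpa using! hV)
  obtain ⟨ε, hε, hball⟩ := Metric.mem_nhds_iff.1 hsymm
  have hW : {y | y ∈ e.source ∧ g y ∈ e'.source ∧
      e'.extend J (g y) ∈ Metric.ball (e'.extend J (g x)) (ε / 2)} ∈ 𝓝 x := by
    have : ContinuousAt (fun y => e'.extend J (g y)) x :=
      ContinuousAt.comp (g := e'.extend J) (continuousAt_extChartAt (g x)) hg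
    filter_upwards [e.open_source.mem_nhds hx, hg (e'.open_source.mem_nhds hgx),
      this (Metric.ball_mem_nhds _ (half_pos hε))] with y h1 h2 h3 using ⟨h1, h2, h3⟩
  obtain ⟨K, hKx, hKW, hK⟩ := local_compact_nhds hW
  have hN : smoothNhd g e e' K 0 (ε / 2) ∈ 𝓝 g := by
    refine IsOpen.mem_nhds (TopologicalSpace.isOpen_generateFrom_of_mem
      ⟨g, e, e', K, 0, ε / 2, IsManifold.chart_mem_maximalAtlas x,
        IsManifold.chart_mem_maximalAtlas (g x), hK, fun y hy => (hKW hy).1,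
        fun y hy => (hKW hy).2.1, half_pos hε, rfl⟩) ⟨fun y hy => (hKW hy).2.1, ?_⟩
    intro k _ y _
    simpa using half_pos hε
  refine Filter.mem_map.2 ?_
  filter_upwards [prod_mem_nhds hN hKx] with ⟨g', y⟩ ⟨hg', hy⟩
  have h0 := hg'.2 0 le_rfl y hy
  have h1 := (hKW hy).2.2
  have hye : (e.extend I).symm (e.extend I y) = y := e.extend_left_inv (hKW hy).1
  rw [← dist_eq_norm, dist_iteratedFDerivWithin_zero, comp_apply, comp_apply, comp_apply,
    comp_apply, hye] at h0
  have h2 : e'.extend J (g' y) ∈ Metric.ball (e'.extend J (g x)) ε := by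
    rw [Metric.mem_ball] at h1 ⊢
    linarith [dist_triangle (e'.extend J (g' y)) (e'.extend J (g y)) (e'.extend J (g x))]
  have h3 := hball h2
  rwa [mem_preimage, e'.extend_left_inv (hg'.1 hy)] at h3

/-- Near a stable value of `g` each map close to `g` has an exceptional value. -/
lemma eventually_exceptionalValues_inter_nonempty [IsManifold I ∞ M] [IsManifold J ∞ P]
    [LocallyCompactSpace M] {g : ContMDiffMap I J M P ∞} {c : P} (hc : c ∈ stableValues g)
    {V : Set P} (hV : V ∈ 𝓝 c) : ∀ᶠ g' in 𝓝 g, (exceptionalValues g' ∩ V).Nonempty := by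
  have key : ∀ x, g x = c → ∀ᶠ p in 𝓝 g ×ˢ 𝓝 x, p.1 p.2 ∈ V := by
    rintro x rfl
    rw [← nhds_prod_eq]
    exact continuous_eval_contMDiffMap.continuousAt.preimage_mem_nhds hV
  rcases hc with ⟨x, hx, hxc⟩ | ⟨x, hx, hxc⟩
  · filter_upwards [(key x hxc).curry] with g' hg'
    exact ⟨g' x, Or.inr ⟨x, hx, rfl⟩, hg'.self_of_nhds⟩
  · obtain ⟨N, hN, U, hU, H⟩ := Filter.mem_prod_iff.1 (key x hxc)
    obtain ⟨N', hN', H'⟩ := hx.2 U hU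
    filter_upwards [hN, hN'] with g' h1 h2
    obtain ⟨y, hy, hc⟩ := H' g' h2
    exact ⟨g' y, Or.inl ⟨y, hc, rfl⟩, H (mk_mem_prod h1 hy)⟩

/-! ### Boundary values and extremal values -/

lemma isBoundaryPoint_iff_extChartAt_mem_frontier [FiniteDimensional ℝ E] [IsManifold I ∞ M]
    {x y : M} (hy : y ∈ (extChartAt I x).source) :
    I.IsBoundaryPoint y ↔ extChartAt I x y ∈ frontier (range I) := by
  have hy' : y ∈ (chartAt H x).source := by simpa using hy
  rw [← not_iff_not, ← I.isInteriorPoint_iff_not_isBoundaryPoint,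
    I.isInteriorPoint_iff_of_mem_atlas (n := ∞) (by simp) (chart_mem_atlas H x) hy',
    ← mem_interior_iff_notMem_frontier (extChartAt_target_subset_range x
      ((extChartAt I x).map_source hy))]
  refine ⟨fun h => interior_mono ((chartAt H x).extend_target_subset_range) h, fun h => ?_⟩
  exact (chartAt H x).mem_interior_extend_target ((chartAt H x).map_source hy') h

/-- The frontier is a hyperplane, or empty if `ℓ = 0`. -/
lemma convex_frontier_setOf_nonneg [FiniteDimensional ℝ E] (ℓ : E →L[ℝ] ℝ) :
    Convex ℝ (frontier {x | 0 ≤ ℓ x}) := by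
  by_cases hℓ : ℓ = 0
  · simpa [hℓ] using convex_empty
  · have := FiniteDimensional.complete ℝ E
    have hs : Surjective ℓ := LinearMap.surjective (f := ℓ.toLinearMap)
      fun h => hℓ (ContinuousLinearMap.coe_injective h)
    have : frontier {x | 0 ≤ ℓ x} = ℓ ⁻¹' {0} := by
      rw [← frontier_Ici]
      exact ((ℓ.isOpenMap hs).preimage_frontier_eq_frontier_preimage ℓ.continuous _).symm
    rw [this]
    exact (convex_singleton 0).linear_preimage ℓ.toLinearMap

/-- The components of the boundary are relatively open: near a boundary point a chart identifies
the boundary with the intersection of a ball and the convex frontier of the model. -/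
lemma connectedComponentIn_boundary_mem_nhdsWithin [FiniteDimensional ℝ E] [IsManifold I ∞ M]
    (hI : Convex ℝ (frontier (range I))) {x : M} (hx : x ∈ I.boundary M) :
    connectedComponentIn (I.boundary M) x ∈ 𝓝[I.boundary M] x := by
  obtain ⟨ε, hε, hball⟩ := Metric.mem_nhdsWithin_iff.1 (extChartAt_target_mem_nhdsWithin (I := I) x)
  set A := Metric.ball (extChartAt I x x) ε ∩ frontier (range I)
  have hA : A ⊆ (extChartAt I x).target := fun z hz =>
    hball ⟨hz.1, I.isClosed_range.frontier_subset hz.2⟩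
  have hpre : IsPreconnected ((extChartAt I x).symm '' A) :=
    ((convex_ball _ _).inter hI).isPreconnected.image _
      ((continuousOn_extChartAt_symm x).mono hA)
  have hsub : (extChartAt I x).symm '' A ⊆ I.boundary M := by
    rintro _ ⟨z, hz, rfl⟩
    refine (isBoundaryPoint_iff_extChartAt_mem_frontier
      ((extChartAt I x).map_target (hA hz))).2 ?_
    rw [(extChartAt I x).right_inv (hA hz)]
    exact hz.2
  have hmem : ∀ y ∈ (extChartAt I x).source, y ∈ I.boundary M →
      extChartAt I x y ∈ Metric.ball (extChartAt I x x) ε → y ∈ (extChartAt I x).symm '' A :=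
    fun y hy hyb hyε => ⟨_, ⟨hyε, (isBoundaryPoint_iff_extChartAt_mem_frontier hy).1 hyb⟩,
      (extChartAt I x).left_inv hy⟩
  filter_upwards [nhdsWithin_le_nhds (extChartAt_source_mem_nhds (I := I) x),
    nhdsWithin_le_nhds ((continuousAt_extChartAt (I := I) x).preimage_mem_nhds
      (Metric.ball_mem_nhds _ hε)), self_mem_nhdsWithin] with y hy hyε hyb
  exact hpre.subset_connectedComponentIn
    (hmem x (mem_extChartAt_source x) hx (Metric.mem_ball_self hε)) hsub (hmem y hy hyb hyε)

lemma finite_image_boundary [FiniteDimensional ℝ E] [IsManifold I ∞ M] [CompactSpace M]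
    (hI : Convex ℝ (frontier (range I))) {Y : Type*} {f : M → Y}
    (hf : ∀ x ∈ I.boundary M, ∀ y ∈ connectedComponentIn (I.boundary M) x, f y = f x) :
    (f '' I.boundary M).Finite := by
  obtain ⟨t, ht, hcover⟩ := (I.isClosed_boundary (M := M) (n := ∞) (by simp)).isCompact
    |>.elim_nhdsWithin_subcover _ fun x hx => connectedComponentIn_boundary_mem_nhdsWithin hI hx
  refine (t.finite_toSet.image f).subset ?_
  rintro _ ⟨y, hy, rfl⟩
  obtain ⟨x, hx, hxy⟩ := mem_iUnion₂.1 (hcover hy)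
  exact ⟨x, hx, (hf x (ht x hx) y hxy).symm⟩

lemma BoundaryConstFinCrit.finite_exceptionalValues [FiniteDimensional ℝ E] [IsManifold I ∞ M]
    [CompactSpace M] (hI : Convex ℝ (frontier (range I))) {f : ContMDiffMap I J M P ∞}
    (hf : BoundaryConstFinCrit f) : (exceptionalValues f).Finite :=
  hf.2.union (finite_image_boundary hI hf.1)

/-- An interior local extremum is a critical point; on the boundary it need not be one, but
the value is exceptional in any case. -/
lemma apply_mem_exceptionalValues_of_isLocalExtr {f : ContMDiffMap I 𝓘(ℝ, ℝ) M ℝ ∞} {x : M}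
    (hx : IsLocalExtr f x) : f x ∈ exceptionalValues f := by
  rcases I.isInteriorPoint_or_isBoundaryPoint x with hi | hb
  · refine Or.inl ⟨x, ?_, rfl⟩
    have hd : MDifferentiableAt I 𝓘(ℝ, ℝ) f x := f.contMDiff.mdifferentiable (by simp) x
    refine hd.mfderiv.trans ?_
    refine (fderivWithin_of_mem_nhds (range_mem_nhds_isInteriorPoint hi)).trans ?_
    refine IsLocalExtr.fderiv_eq_zero ?_
    have ht := (continuousAt_extChartAt_symm (I := I) x).tendsto
    rw [extChartAt_to_inv] at ht
    have hx' : IsExtrFilter f (𝓝 x) ((extChartAt I x).symm (extChartAt I x x)) := by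
      rwa [extChartAt_to_inv]
    exact hx'.comp_tendsto ht
  · exact Or.inr ⟨x, hb, rfl⟩

lemma isLeast_sInf_exceptionalValues [CompactSpace M] [Nonempty M]
    (f : ContMDiffMap I 𝓘(ℝ, ℝ) M ℝ ∞) : IsLeast (exceptionalValues f) (sInf (range f)) := by
  have hK : IsCompact (range f) := isCompact_range f.contMDiff.continuous
  have hle : ∀ y, sInf (range f) ≤ f y := fun y => csInf_le hK.bddBelow (mem_range_self y)
  obtain ⟨x, hx⟩ := hK.sInf_mem (range_nonempty f)
  refine ⟨?_, ?_⟩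
  · rw [← hx] at hle ⊢
    exact apply_mem_exceptionalValues_of_isLocalExtr (Or.inl (Filter.Eventually.of_forall hle))
  · rintro _ (⟨y, -, rfl⟩ | ⟨y, -, rfl⟩) <;> exact hle y

lemma isGreatest_sSup_exceptionalValues [CompactSpace M] [Nonempty M]
    (f : ContMDiffMap I 𝓘(ℝ, ℝ) M ℝ ∞) : IsGreatest (exceptionalValues f) (sSup (range f)) := by
  have hK : IsCompact (range f) := isCompact_range f.contMDiff.continuous
  have hle : ∀ y, f y ≤ sSup (range f) := fun y => le_csSup hK.bddAbove (mem_range_self y)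
  obtain ⟨x, hx⟩ := hK.sSup_mem (range_nonempty f)
  refine ⟨?_, ?_⟩
  · rw [← hx] at hle ⊢
    exact apply_mem_exceptionalValues_of_isLocalExtr (Or.inr (Filter.Eventually.of_forall hle))
  · rintro _ (⟨y, -, rfl⟩ | ⟨y, -, rfl⟩) <;> exact hle y

end Transport

/-! ### Families of finite sets with a fixed number of points -/

/-- If the sets `E g` all have `n` points and each point of `E g₀` persists nearby in `E g`, then
`E g` has an enumeration close to a given enumeration of `E g₀`: by counting, each of
`n` disjoint small neighbourhoods of the points of `E g₀` contains exactly one point of `E g`. -/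
lemma eventually_exists_enumeration {X P : Type*} [TopologicalSpace X] [TopologicalSpace P]
    [T2Space P] {n : ℕ} {E : X → Set P} (hfin : ∀ g, (E g).Finite) (hcard : ∀ g, (E g).ncard = n)
    {g₀ : X} (hE : ∀ c ∈ E g₀, ∀ V ∈ 𝓝 c, ∀ᶠ g in 𝓝 g₀, (E g ∩ V).Nonempty)
    {x₀ : Fin n → P} (hinj : Injective x₀) (hx₀ : range x₀ = E g₀) {B : Set (Fin n → P)}
    (hB : B ∈ 𝓝 x₀) : ∀ᶠ g in 𝓝 g₀, ∃ y ∈ B, Injective y ∧ range y = E g := by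
  obtain ⟨U, hU, hdisj⟩ := (finite_range x₀).t2_separation
  rw [nhds_pi, Filter.mem_pi] at hB
  obtain ⟨s, -, W, hW, hWB⟩ := hB
  have hev : ∀ᶠ g in 𝓝 g₀, ∀ i, (E g ∩ (U (x₀ i) ∩ W i)).Nonempty :=
    Filter.eventually_all.2 fun i => hE (x₀ i) (hx₀ ▸ mem_range_self i) _
      (Filter.inter_mem ((hU _).2.mem_nhds (hU _).1) (hW i))
  filter_upwards [hev] with g hg
  choose y hyE hyU hyW using hg
  have hyinj : Injective y := by
    intro i j hij
    by_contra hne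
    exact disjoint_left.1 (hdisj (mem_range_self i) (mem_range_self j) (hinj.ne hne)) (hyU i)
      (hij ▸ hyU j)
  refine ⟨y, hWB fun i _ => hyW i, hyinj, ?_⟩
  refine eq_of_subset_of_ncard_le (range_subset_iff.2 hyE) ?_ (hfin g)
  rw [hcard, ← image_univ, ncard_image_of_injective _ hyinj, ncard_univ, Nat.card_fin]

/-- A finite set of reals is enumerated by a point of the ordered configuration space. -/
lemma exists_orderedConf {S : Set ℝ} (hS : S.Finite) {n : ℕ} (hn : S.ncard = n) {a b : ℝ}
    (ha : IsLeast S a) (hb : IsGreatest S b) : ∃ x : OrderedConf n a b, range x.1 = S := by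
  obtain ⟨t, ht, rfl⟩ : ∃ t : Fin n → ℝ, StrictMono t ∧ range t = S := by
    rw [ncard_eq_toFinset_card S hS] at hn
    exact ⟨_, (hS.toFinset.orderEmbOfFin hn).strictMono, by simp⟩
  refine ⟨⟨t, ht, fun i hi => ?_, fun i hi => ?_⟩, rfl⟩
  · refine IsLeast.unique ⟨mem_range_self i, forall_mem_range.2 fun j => ?_⟩ ha
    exact ht.monotone (Fin.le_def.2 (by omega))
  · refine IsGreatest.unique ⟨mem_range_self i, forall_mem_range.2 fun j => ?_⟩ hb
    exact ht.monotone (Fin.le_def.2 (by omega))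

lemma isOpen_setOf_strictMono (n : ℕ) : IsOpen {x : Fin n → ℝ | StrictMono x} := by
  have : {x : Fin n → ℝ | StrictMono x} = ⋂ i, ⋂ j, ⋂ (_ : i < j), {x | x i < x j} := by
    ext x
    simp [StrictMono]
  rw [this]
  exact isOpen_iInter_of_finite fun i => isOpen_iInter_of_finite fun j =>
    isOpen_iInter_of_finite fun _ => isOpen_lt (continuous_apply i) (continuous_apply j)

/-- The ordered enumeration of a family of finite sets depends continuously on the parameter. -/
lemma continuous_orderedConf {X : Type*} [TopologicalSpace X] {n : ℕ} {a b : ℝ} {E : X → Set ℝ}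
    (hfin : ∀ g, (E g).Finite) (hcard : ∀ g, (E g).ncard = n)
    (hE : ∀ g₀, ∀ c ∈ E g₀, ∀ V ∈ 𝓝 c, ∀ᶠ g in 𝓝 g₀, (E g ∩ V).Nonempty)
    {κ : X → OrderedConf n a b} (hκ : ∀ g, range (κ g).1 = E g) : Continuous κ := by
  refine continuous_induced_rng.2 (continuous_iff_continuousAt.2 fun g₀ B hB => ?_)
  have hmono : {x : Fin n → ℝ | StrictMono x} ∈ 𝓝 (κ g₀).1 :=
    (isOpen_setOf_strictMono n).mem_nhds (κ g₀).2.1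
  refine Filter.mem_map.2 ?_
  filter_upwards [eventually_exists_enumeration hfin hcard (hE g₀) (κ g₀).2.1.injective (hκ g₀)
    (Filter.inter_mem hB hmono)] with g ⟨y, ⟨hyB, hy⟩, _, hyr⟩
  have : (κ g).1 = y := ((κ g).2.1.range_inj hy).1 ((hκ g).trans hyr.symm)
  rwa [mem_preimage, comp_apply, this]

/-! ### Cyclically ordered configurations on the circle -/

open Real in
/-- The angle in `(0, 2π]` from `z` counterclockwise to `w`; it is `2π` if `w = z`. -/
noncomputable def angleFrom (z w : Circle) : ℝ := Complex.arg (-(w / z : ℂ)) + π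

open Real in
lemma coe_neg_exp_sub_pi (t : ℝ) : -(Circle.exp t : ℂ) = Circle.exp (t - π) := by
  rw [Circle.exp_sub, Circle.coe_div, Circle.coe_exp π, Complex.exp_pi_mul_I, div_neg, div_one]

open Real in
lemma angleFrom_exp_mul {t : ℝ} (h0 : 0 < t) (h1 : t ≤ 2 * π) (z : Circle) :
    angleFrom z (Circle.exp t * z) = t := by
  rw [angleFrom, ← Circle.coe_div, mul_div_cancel_right, coe_neg_exp_sub_pi,
    Circle.arg_exp (by linarith) (by linarith)]
  ring

lemma exp_angleFrom_mul (z w : Circle) : Circle.exp (angleFrom z w) * z = w := by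
  obtain ⟨t, ht⟩ := Circle.exp_surjective (w / z)
  have h : -(w / z : ℂ) = Circle.exp (t - Real.pi) := by
    rw [← coe_neg_exp_sub_pi, ht, Circle.coe_div]
  rw [angleFrom, h, Circle.exp_add, Circle.exp_arg, ← Circle.exp_add, sub_add_cancel, ht,
    div_mul_cancel]

lemma angleFrom_pos (z w : Circle) : 0 < angleFrom z w := by
  rw [angleFrom]
  linarith [Complex.neg_pi_lt_arg (-(w / z : ℂ))]

lemma angleFrom_le (z w : Circle) : angleFrom z w ≤ 2 * Real.pi := by
  rw [angleFrom]
  linarith [Complex.arg_le_pi (-(w / z : ℂ))]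

lemma angleFrom_injective (z : Circle) : Injective (angleFrom z) := fun w w' h => by
  rw [← exp_angleFrom_mul z w, h, exp_angleFrom_mul]

lemma angleFrom_self (z : Circle) : angleFrom z z = 2 * Real.pi := by
  simpa using angleFrom_exp_mul Real.two_pi_pos le_rfl z

lemma angleFrom_lt {z w : Circle} (h : w ≠ z) : angleFrom z w < 2 * Real.pi :=
  (angleFrom_le z w).lt_of_ne fun h' =>
    h (angleFrom_injective z (h'.trans (angleFrom_self z).symm))

lemma continuousAt_angleFrom {z w : Circle} (h : w ≠ z) :
    ContinuousAt (fun p : Circle × Circle => angleFrom p.1 p.2) (z, w) := by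
  refine ContinuousAt.add ?_ continuousAt_const
  have hslit : -(w / z : ℂ) ∈ Complex.slitPlane := by
    refine Complex.mem_slitPlane_iff_arg.2 ⟨fun h' => ?_, ?_⟩
    · have := angleFrom_lt h
      rw [angleFrom, h'] at this
      linarith
    · simp
  refine ContinuousAt.comp (g := Complex.arg) (Complex.continuousAt_arg hslit) ?_
  have : Continuous fun p : Circle × Circle => -((p.2 / p.1 : Circle) : ℂ) :=
    (continuous_induced_dom.comp
      (show Continuous fun p : Circle × Circle => p.2 / p.1 from
        continuous_snd.div' continuous_fst)).neg
  simpa only [Circle.coe_div] using this.continuousAt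

/-- The tuples of points of the circle listed in counterclockwise order: the angles measured from
the last point are increasing. These angles lie in `(0, 2π]`, and that of the last
point is `2π`, so the points are distinct. -/
def cyclicallyOrdered (k : ℕ) : Set (Fin (k + 1) → Circle) :=
  {x | StrictMono fun i => angleFrom (x (Fin.last k)) (x i)}

lemma cyclicallyOrdered.injective {k : ℕ} {x : Fin (k + 1) → Circle}
    (hx : x ∈ cyclicallyOrdered k) : Injective x :=
  fun _ _ h => StrictMono.injective hx (congrArg (angleFrom _) h)

lemma isOpen_cyclicallyOrdered (k : ℕ) : IsOpen (cyclicallyOrdered k) := by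
  refine isOpen_iff_mem_nhds.2 fun x hx => ?_
  have hinj := cyclicallyOrdered.injective hx
  have hcont : ∀ i < Fin.last k,
      ContinuousAt (fun y : Fin (k + 1) → Circle => angleFrom (y (Fin.last k)) (y i)) x :=
    fun i hi => ContinuousAt.comp (g := fun p : Circle × Circle => angleFrom p.1 p.2)
      (f := fun y : Fin (k + 1) → Circle => (y (Fin.last k), y i))
      (continuousAt_angleFrom (hinj.ne hi.ne)) (by fun_prop)
  have key : ∀ᶠ y in 𝓝 x, ∀ i j : Fin (k + 1), i < j →
      angleFrom (y (Fin.last k)) (y i) < angleFrom (y (Fin.last k)) (y j) := by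
    refine Filter.eventually_all.2 fun i => Filter.eventually_all.2 fun j =>
      Filter.eventually_all.2 fun hij => ?_
    have hi : i < Fin.last k := hij.trans_le (Fin.le_last j)
    rcases (Fin.le_last j).eq_or_lt with rfl | hj
    · have : ∀ᶠ y : Fin (k + 1) → Circle in 𝓝 x, y i ≠ y (Fin.last k) :=
        (isClosed_eq (continuous_apply i) (continuous_apply (Fin.last k))).isOpen_compl.mem_nhds
          (hinj.ne hi.ne)
      filter_upwards [this] with y hy
      rw [angleFrom_self]
      exact angleFrom_lt hy
    · exact (hcont i hi).eventually_lt (hcont j hj) (hx hij)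
  filter_upwards [key] with y hy i j hij using hy i j hij

/-- A preconnected set of tuples of distinct points that meets the cyclically ordered tuples
consists of such tuples, since differences of angles cannot change sign in it. -/
lemma subset_cyclicallyOrdered {k : ℕ} {S : Set (Fin (k + 1) → Circle)} (hS : IsPreconnected S)
    (hinj : S ⊆ {y | Injective y}) {x : Fin (k + 1) → Circle} (hxS : x ∈ S)
    (hx : x ∈ cyclicallyOrdered k) : S ⊆ cyclicallyOrdered k := by
  intro y hy i j hij
  have hi : i < Fin.last k := hij.trans_le (Fin.le_last j)
  change angleFrom (y (Fin.last k)) (y i) < angleFrom (y (Fin.last k)) (y j)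
  rcases (Fin.le_last j).eq_or_lt with rfl | hj
  · rw [angleFrom_self]
    exact angleFrom_lt ((hinj hy).ne hi.ne)
  · have hcont : ∀ i < Fin.last k,
        ContinuousOn (fun y : Fin (k + 1) → Circle => angleFrom (y (Fin.last k)) (y i)) S :=
      fun i hi y hy => (ContinuousAt.comp (g := fun p : Circle × Circle => angleFrom p.1 p.2)
        (f := fun y : Fin (k + 1) → Circle => (y (Fin.last k), y i))
        (continuousAt_angleFrom ((hinj hy).ne hi.ne)) (by fun_prop)).continuousWithinAt
    by_contra hle
    obtain ⟨z, hz, hz0⟩ := hS.intermediate_value₂ hxS hy (hcont i hi) (hcont j hj)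
      (hx hij).le (not_lt.1 hle)
    exact hij.ne (hinj hz (angleFrom_injective _ hz0))

lemma isPreconnected_cyclicallyOrdered (k : ℕ) : IsPreconnected (cyclicallyOrdered k) := by
  set T : Set (Fin (k + 1) → ℝ) :=
    {t | (∀ i j, i < j → t i < t j) ∧ (∀ i, 0 < t i) ∧ t (Fin.last k) = 2 * Real.pi}
  have hconv : Convex ℝ T := by
    intro s hs t ht a b ha hb hab
    refine ⟨fun i j hij => ?_, fun i => ?_, ?_⟩
    · have h1 := hs.1 i j hij
      have h2 := ht.1 i j hij
      simp only [Pi.add_apply, Pi.smul_apply, smul_eq_mul]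
      rcases ha.eq_or_lt with rfl | ha
      · obtain rfl : b = 1 := by linarith
        linarith
      · nlinarith [mul_le_mul_of_nonneg_left h2.le hb, mul_lt_mul_of_pos_left h1 ha]
    · have h1 := hs.2.1 i
      have h2 := ht.2.1 i
      simp only [Pi.add_apply, Pi.smul_apply, smul_eq_mul]
      rcases ha.eq_or_lt with rfl | ha
      · obtain rfl : b = 1 := by linarith
        linarith
      · nlinarith [mul_nonneg hb h2.le, mul_pos ha h1]
    · simp only [Pi.add_apply, Pi.smul_apply, smul_eq_mul, hs.2.2, ht.2.2]
      rw [← add_mul, hab, one_mul]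
  have himage : cyclicallyOrdered k =
      (fun (p : Circle × (Fin (k + 1) → ℝ)) i => Circle.exp (p.2 i) * p.1) '' (univ ×ˢ T) := by
    refine Subset.antisymm (fun x hx => ?_) ?_
    · exact ⟨(x (Fin.last k), fun i => angleFrom (x (Fin.last k)) (x i)),
        ⟨mem_univ _, fun i j hij => hx hij, fun i => angleFrom_pos _ _, angleFrom_self _⟩,
        funext fun i => exp_angleFrom_mul _ _⟩
    · rintro _ ⟨⟨z, t⟩, ⟨-, hmono, hpos, hlast⟩, rfl⟩
      have hle : ∀ i, t i ≤ 2 * Real.pi := fun i =>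
        hlast ▸ (StrictMono.monotone hmono) (Fin.le_last i)
      intro i j hij
      have hz : Circle.exp (t (Fin.last k)) * z = z := by
        rw [show t (Fin.last k) = _ from hlast, Circle.exp_two_pi, one_mul]
      simp only [hz]
      rw [angleFrom_exp_mul (hpos i) (hle i), angleFrom_exp_mul (hpos j) (hle j)]
      exact hmono i j hij
  rw [himage]
  refine (isPreconnected_univ.prod hconv.isPreconnected).image _ (Continuous.continuousOn ?_)
  fun_prop

/-- Equally spaced points on the circle, listed in counterclockwise order. -/
noncomputable def equallySpaced (n : ℕ) (i : Fin n) : Circle :=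
  Circle.exp (2 * Real.pi * ((i : ℝ) + 1) / n)

lemma equallySpaced_last (k : ℕ) : equallySpaced (k + 1) (Fin.last k) = 1 := by
  have : (k : ℝ) + 1 ≠ 0 := by positivity
  simp [equallySpaced, this]

lemma equallySpaced_mem_cyclicallyOrdered (k : ℕ) :
    equallySpaced (k + 1) ∈ cyclicallyOrdered k := by
  have hk : (0 : ℝ) < k + 1 := by positivity
  have hangle : ∀ i : Fin (k + 1), angleFrom 1 (equallySpaced (k + 1) i) =
      2 * Real.pi * ((i : ℝ) + 1) / (k + 1) := fun i => by
    have hi : (i : ℝ) ≤ k := by exact_mod_cast i.is_le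
    have := angleFrom_exp_mul (t := 2 * Real.pi * ((i : ℝ) + 1) / (k + 1))
      (by positivity) ?_ 1
    · simpa [equallySpaced] using this
    · rw [div_le_iff₀ hk]
      gcongr
  intro i j hij
  have hij' : (i : ℝ) < j := by exact_mod_cast hij
  simp only [equallySpaced_last, hangle]
  have := Real.two_pi_pos
  gcongr

/-- The component of the equally spaced configuration consists of the cyclically ordered ones. -/
lemma connectedComponentIn_equallySpaced (k : ℕ) :
    connectedComponentIn {y : Fin (k + 1) → Circle | Injective y} (equallySpaced (k + 1)) =
      cyclicallyOrdered k := by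
  have hmem := equallySpaced_mem_cyclicallyOrdered k
  have hsub : cyclicallyOrdered k ⊆ {y | Injective y} :=
    fun x hx => cyclicallyOrdered.injective hx
  refine Subset.antisymm ?_
    ((isPreconnected_cyclicallyOrdered k).subset_connectedComponentIn hmem hsub)
  exact subset_cyclicallyOrdered isPreconnected_connectedComponentIn
    (connectedComponentIn_subset _ _) (mem_connectedComponentIn (hsub hmem)) hmem

/-- A cyclic shift rotates the equally spaced configuration, hence preserves its component. -/
lemma comp_finRotate_mem_cyclicallyOrdered {k : ℕ} {x : Fin (k + 1) → Circle}
    (hx : x ∈ cyclicallyOrdered k) : x ∘ finRotate (k + 1) ∈ cyclicallyOrdered k := by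
  have hshift : equallySpaced (k + 1) ∘ finRotate (k + 1) =
      fun i => Circle.exp (2 * Real.pi / (k + 1)) * equallySpaced (k + 1) i := by
    have hk : (k : ℝ) + 1 ≠ 0 := by positivity
    funext i
    rw [comp_apply]
    rcases (Fin.le_last i).eq_or_lt with rfl | hi
    · rw [finRotate_last, equallySpaced_last, mul_one]
      simp [equallySpaced]
    · rw [equallySpaced, equallySpaced, ← Circle.exp_add, coe_finRotate_of_ne_last hi.ne]
      congr 1
      push_cast
      field_simp
      ring
  have hrot : ∀ c : Circle, (fun i => c * equallySpaced (k + 1) i) ∈ cyclicallyOrdered k := by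
    intro c i j hij
    have := equallySpaced_mem_cyclicallyOrdered k hij
    simpa [angleFrom, mul_div_mul_left] using this
  refine subset_cyclicallyOrdered (S := (fun y => y ∘ finRotate (k + 1)) '' cyclicallyOrdered k)
    ((isPreconnected_cyclicallyOrdered k).image _ (Continuous.continuousOn (by fun_prop)))
    ?_ (mem_image_of_mem _ (equallySpaced_mem_cyclicallyOrdered k)) ?_ (mem_image_of_mem _ hx)
  · rintro _ ⟨y, hy, rfl⟩
    exact (cyclicallyOrdered.injective hy).comp (finRotate (k + 1)).injective
  · simpa only [hshift] using hrot _

lemma comp_finRotate_pow_mem_cyclicallyOrdered {k : ℕ} {x : Fin (k + 1) → Circle}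
    (hx : x ∈ cyclicallyOrdered k) (l : ℕ) :
    x ∘ (finRotate (k + 1) ^ l : Equiv.Perm (Fin (k + 1))) ∈ cyclicallyOrdered k := by
  induction l with
  | zero => simpa using hx
  | succ l ih =>
    rw [pow_succ, Equiv.Perm.coe_mul, ← comp_assoc]
    exact comp_finRotate_mem_cyclicallyOrdered ih

lemma exists_finRotate_pow_apply_eq {k : ℕ} (i j : Fin (k + 1)) :
    ∃ l : ℕ, (finRotate (k + 1) ^ l : Equiv.Perm (Fin (k + 1))) i = j := by
  have h : ∀ l : ℕ, (finRotate (k + 1) ^ l : Equiv.Perm (Fin (k + 1))) i =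
      i + Fin.ofNat (k + 1) l := by
    intro l
    induction l with
    | zero => simp
    | succ l ih =>
      rw [pow_succ', Equiv.Perm.mul_apply, ih, finRotate_apply, add_assoc]
      congr 1
      ext
      simp [Fin.val_add]
  exact ⟨(j - i).val, by rw [h, Fin.ofNat_val_eq_self, add_sub_cancel]⟩

/-- Cyclically ordered tuples with the same points differ by a cyclic shift: once their
last points agree, both list the points in the order of the angles from it. -/
lemma exists_shift_of_range_eq {k : ℕ} {x y : Fin (k + 1) → Circle}
    (hx : x ∈ cyclicallyOrdered k) (hy : y ∈ cyclicallyOrdered k) (h : range x = range y) :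
    ∃ l : ℤ, y = x ∘ (finRotate (k + 1) ^ l : Equiv.Perm (Fin (k + 1))) := by
  obtain ⟨i, hi⟩ : y (Fin.last k) ∈ range x := h ▸ mem_range_self _
  obtain ⟨l, hl⟩ := exists_finRotate_pow_apply_eq (Fin.last k) i
  have hx' := comp_finRotate_pow_mem_cyclicallyOrdered hx l
  set x' := x ∘ (finRotate (k + 1) ^ l : Equiv.Perm (Fin (k + 1))) with hdef
  have hlast : x' (Fin.last k) = y (Fin.last k) := by rw [hdef, comp_apply, hl, hi]
  have hr : range x' = range y := by rw [hdef, (Equiv.surjective _).range_comp, h]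
  have hangle : StrictMono (angleFrom (y (Fin.last k)) ∘ x') := by
    rw [← hlast]
    exact hx'
  have heq := (hangle.range_inj hy).1 (by
    rw [range_comp, hr, ← range_comp]
    rfl)
  refine ⟨l, ?_⟩
  rw [zpow_natCast, ← hdef]
  exact funext fun j => (angleFrom_injective _ (congrFun heq j)).symm

lemma exists_cyclicallyOrdered {k : ℕ} {S : Set Circle} (hS : S.Finite) (hn : S.ncard = k + 1) :
    ∃ x ∈ cyclicallyOrdered k, range x = S := by
  obtain ⟨z, hz⟩ : S.Nonempty := by
    rw [← ncard_pos hS]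
    omega
  have hA : (angleFrom z '' S).ncard = k + 1 := by
    rw [ncard_image_of_injective _ (angleFrom_injective z), hn]
  obtain ⟨w, hw, hmin⟩ := exists_min_image S (angleFrom z) hS ⟨z, hz⟩
  obtain ⟨t, ht⟩ := exists_orderedConf (hS.image (angleFrom z)) hA
    ⟨mem_image_of_mem _ hw, forall_mem_image.2 hmin⟩
    (b := 2 * Real.pi) ⟨⟨z, hz, angleFrom_self z⟩, forall_mem_image.2 fun w _ => angleFrom_le z w⟩
  choose x hxS hx using fun i => (ht ▸ mem_range_self i : t.1 i ∈ angleFrom z '' S)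
  have hlast : x (Fin.last k) = z := angleFrom_injective z (by
    rw [hx, angleFrom_self, t.2.2.2 _ (by simp)])
  refine ⟨x, ?_, Subset.antisymm (range_subset_iff.2 hxS) fun w hw => ?_⟩
  · change StrictMono fun i => angleFrom (x (Fin.last k)) (x i)
    simp only [hlast, hx]
    exact t.2.1
  · obtain ⟨i, hi⟩ : angleFrom z w ∈ range t.1 := ht ▸ mem_image_of_mem _ hw
    exact ⟨i, angleFrom_injective z ((hx i).trans hi)⟩

lemma CircleConf.injective {n : ℕ} (x : CircleConf n) : Injective x.1 :=
  connectedComponentIn_subset _ _ x.2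

lemma CircleConf.mem_cyclicallyOrdered {k : ℕ} (x : CircleConf (k + 1)) :
    x.1 ∈ cyclicallyOrdered k :=
  (connectedComponentIn_equallySpaced k).subset x.2

lemma exists_circleConf {n : ℕ} {S : Set Circle} (hS : S.Finite) (hn : S.ncard = n) :
    ∃ x : CircleConf n, range x.1 = S := by
  cases n with
  | zero =>
    refine ⟨⟨_, mem_connectedComponentIn (injective_of_subsingleton _)⟩, ?_⟩
    rw [(ncard_eq_zero hS).1 hn, range_eq_empty]
  | succ k =>
    obtain ⟨x, hx, hr⟩ := exists_cyclicallyOrdered hS hn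
    rw [← connectedComponentIn_equallySpaced] at hx
    exact ⟨⟨x, hx⟩, hr⟩

/-- Two tuples in the component have the same points exactly if they are in the same orbit. -/
lemma circleConf_mk_eq_iff {n : ℕ} (x y : CircleConf n) :
    (Quotient.mk (cyclicShiftSetoid n) x = Quotient.mk _ y) ↔ range x.1 = range y.1 := by
  rw [Quotient.eq]
  refine ⟨fun ⟨l, hl⟩ => ?_, fun h => ?_⟩
  · rw [hl, (Equiv.surjective _).range_comp]
  · cases n with
    | zero => exact ⟨0, Subsingleton.elim _ _⟩
    | succ k => exact exists_shift_of_range_eq x.mem_cyclicallyOrdered y.mem_cyclicallyOrdered h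

lemma circleConf_mem_nhds {n : ℕ} (x : CircleConf n) :
    connectedComponentIn {y : Fin n → Circle | Injective y} (equallySpaced n) ∈ 𝓝 x.1 := by
  cases n with
  | zero =>
    convert Filter.univ_mem
    exact eq_univ_of_forall fun y => Subsingleton.elim x.1 y ▸ x.2
  | succ k =>
    rw [connectedComponentIn_equallySpaced]
    exact (isOpen_cyclicallyOrdered k).mem_nhds x.mem_cyclicallyOrdered

/-- The cyclic configuration of a family of finite subsets of the circle depends continuously on
the parameter. -/
lemma continuous_cyclicConf {X : Type*} [TopologicalSpace X] {n : ℕ} {E : X → Set Circle}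
    (hfin : ∀ g, (E g).Finite) (hcard : ∀ g, (E g).ncard = n)
    (hE : ∀ g₀, ∀ c ∈ E g₀, ∀ V ∈ 𝓝 c, ∀ᶠ g in 𝓝 g₀, (E g ∩ V).Nonempty)
    {κ : X → CyclicConf n} (hκ : ∀ g x, κ g = Quotient.mk _ x ↔ range x.1 = E g) :
    Continuous κ := by
  refine continuous_iff_continuousAt.2 fun g₀ B hB => ?_
  obtain ⟨x₀, hx₀⟩ := exists_circleConf (hfin g₀) (hcard g₀)
  rw [(hκ g₀ x₀).2 hx₀] at hB
  have hpre : Quotient.mk (cyclicShiftSetoid n) ⁻¹' B ∈ 𝓝 x₀ :=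
    continuous_quotient_mk'.continuousAt hB
  rw [nhds_subtype_eq_comap] at hpre
  obtain ⟨W, hW, hWB⟩ := hpre
  refine Filter.mem_map.2 ?_
  filter_upwards [eventually_exists_enumeration hfin hcard (hE g₀) x₀.injective hx₀
    (Filter.inter_mem hW (circleConf_mem_nhds x₀))] with g ⟨y, ⟨hyW, hy⟩, _, hyr⟩
  rw [mem_preimage, (hκ g ⟨y, hy⟩).2 hyr]
  exact hWB (show (⟨y, hy⟩ : CircleConf n) ∈ Subtype.val ⁻¹' W from hyW)

/-! ### Exceptional values along the orbit -/

section Orbit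

variable {E : Type*} [NormedAddCommGroup E] [NormedSpace ℝ E] [FiniteDimensional ℝ E]
  {H : Type*} [TopologicalSpace H] {I : ModelWithCorners ℝ E H}
  {M : Type*} [TopologicalSpace M] [ChartedSpace H M] [IsManifold I ∞ M]
  {F : Type*} [NormedAddCommGroup F] [NormedSpace ℝ F]
  {G : Type*} [TopologicalSpace G] {J : ModelWithCorners ℝ F G}
  {P : Type*} [TopologicalSpace P] [ChartedSpace G P]
  {D : Set (Diffeomorph J J P P ∞)} {f : ContMDiffMap I J M P ∞}

lemma finite_exceptionalValues_of_mem_orbit (hf : (exceptionalValues f).Finite)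
    {g : ContMDiffMap I J M P ∞} (hg : g ∈ leftRightOrbit D f) : (exceptionalValues g).Finite := by
  obtain ⟨φ, -, h, rfl⟩ := exists_eq_leftRight hg
  rw [exceptionalValues_leftRight]
  exact hf.image φ

lemma ncard_exceptionalValues_of_mem_orbit {g : ContMDiffMap I J M P ∞}
    (hg : g ∈ leftRightOrbit D f) : (exceptionalValues g).ncard = (exceptionalValues f).ncard := by
  obtain ⟨φ, -, h, rfl⟩ := exists_eq_leftRight hg
  rw [exceptionalValues_leftRight]
  exact ncard_image_of_injective _ φ.injective

/-- On the orbit each exceptional value persists: those of `f` are stable by assumption, and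
the left-right action carries stable values to stable values. -/
lemma eventually_exceptionalValues_inter_nonempty_of_mem_orbit [IsManifold J ∞ P]
    [LocallyCompactSpace M] (hf : CriticalLevelCondition f) (g₀ : leftRightOrbit D f) :
    ∀ c ∈ exceptionalValues g₀.1, ∀ V ∈ 𝓝 c,
      ∀ᶠ g : leftRightOrbit D f in 𝓝 g₀, (exceptionalValues g.1 ∩ V).Nonempty := by
  intro c hc V hV
  obtain ⟨φ, -, h, hg⟩ := exists_eq_leftRight g₀.2
  rw [hg, exceptionalValues_leftRight] at hc
  have hs : c ∈ stableValues g₀.1 := by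
    rw [hg]
    exact image_stableValues_subset φ h f
      (image_mono hf.exceptionalValues_subset_stableValues hc)
  exact continuous_subtype_val.continuousAt.eventually
    (eventually_exceptionalValues_inter_nonempty hs hV)

end Orbit

lemma IsBoundaryModel.convex_frontier_range {m : ℕ} {H : Type*} [TopologicalSpace H]
    {I : ModelWithCorners ℝ (EuclideanSpace ℝ (Fin m)) H} (hI : IsBoundaryModel I) :
    Convex ℝ (frontier (range I)) := by
  obtain ⟨ℓ, hℓ⟩ := hI
  rw [hℓ]
  exact convex_frontier_setOf_nonneg ℓ

theorem mainTheorem6 {m : ℕ} {H : Type*} [TopologicalSpace H]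
    (I : ModelWithCorners ℝ (EuclideanSpace ℝ (Fin m)) H) (hI : IsBoundaryModel I)
    (M : Type*) [TopologicalSpace M] [T2Space M] [CompactSpace M] [ConnectedSpace M]
    [ChartedSpace H M] [IsManifold I ∞ M] :
    (∀ f : ContMDiffMap I 𝓘(ℝ, ℝ) M ℝ ∞,
      BoundaryConstFinCrit f → CriticalLevelCondition f →
      ∃ κ : leftRightOrbit (lineDiffeos f) f →
          OrderedConf (exceptionalValues f).ncard (sInf (range f)) (sSup (range f)),
        (∀ g, range (κ g).1 = exceptionalValues g.1) ∧ Continuous κ) ∧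
    (∀ f : ContMDiffMap I (𝓡 1) M Circle ∞,
      BoundaryConstFinCrit f → CriticalLevelCondition f →
      ∃ κ : leftRightOrbit circleDiffeos f → CyclicConf (exceptionalValues f).ncard,
        (∀ g x, κ g = Quotient.mk _ x ↔ range x.1 = exceptionalValues g.1) ∧
        Continuous κ) := by
  have hconv := hI.convex_frontier_range
  refine ⟨fun f hf hc => ?_, fun f hf hc => ?_⟩
  · have hfin : ∀ g : leftRightOrbit (lineDiffeos f) f, (exceptionalValues g.1).Finite :=
      fun g => finite_exceptionalValues_of_mem_orbit (hf.finite_exceptionalValues hconv) g.2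
    have hcard : ∀ g : leftRightOrbit (lineDiffeos f) f,
        (exceptionalValues g.1).ncard = (exceptionalValues f).ncard :=
      fun g => ncard_exceptionalValues_of_mem_orbit g.2
    have hrange : ∀ g : leftRightOrbit (lineDiffeos f) f, range g.1 = range f := by
      intro g
      obtain ⟨φ, hφ, h, hg⟩ := exists_eq_leftRight g.2
      rw [hg, range_leftRight]
      exact hφ.2.2
    choose κ hκ using fun g : leftRightOrbit (lineDiffeos f) f =>
      exists_orderedConf (hfin g) (hcard g) (hrange g ▸ isLeast_sInf_exceptionalValues g.1)
        (hrange g ▸ isGreatest_sSup_exceptionalValues g.1)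
    exact ⟨κ, hκ, continuous_orderedConf hfin hcard
      (eventually_exceptionalValues_inter_nonempty_of_mem_orbit hc) hκ⟩
  · have hfin : ∀ g : leftRightOrbit circleDiffeos f, (exceptionalValues g.1).Finite :=
      fun g => finite_exceptionalValues_of_mem_orbit (hf.finite_exceptionalValues hconv) g.2
    have hcard : ∀ g : leftRightOrbit circleDiffeos f,
        (exceptionalValues g.1).ncard = (exceptionalValues f).ncard :=
      fun g => ncard_exceptionalValues_of_mem_orbit g.2
    choose x hx using fun g : leftRightOrbit circleDiffeos f => exists_circleConf (hfin g) (hcard g)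
    have hκ : ∀ (g : leftRightOrbit circleDiffeos f)
        (y : CircleConf (exceptionalValues f).ncard),
        Quotient.mk (cyclicShiftSetoid _) (x g) = Quotient.mk _ y ↔
          range y.1 = exceptionalValues g.1 := fun g y => by
      rw [circleConf_mk_eq_iff, hx g, eq_comm]
    exact ⟨fun g => Quotient.mk _ (x g), hκ, continuous_cyclicConf hfin hcard
      (eventually_exceptionalValues_inter_nonempty_of_mem_orbit hc) hκ⟩
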